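/- Let $n=2m$ be an even positive integer. For a subset $R\subseteq\mathbb{Z}_n=\mathbb{Z}/n\mathbb{Z}$, let $H(\mathbb{Z}_n,R)$ denote the Haar graph: the bipartite graph whose colour classes are two disjoint copies $\mathbb{Z}_n^+=\{x^+ : x\in\mathbb{Z}_n\}$ and $\mathbb{Z}_n^-=\{x^- : x\in\mathbb{Z}_n\}$ of $\mathbb{Z}_n$, and whose edges are the pairs $\{x^+,y^-\}$ with $x,y\in\mathbb{Z}_n$ and $y-x\in R$. Let $u,v$ be integers and let $S=\{0,u,v,v+m\}\subseteq\mathbb{Z}_n$ (residues modulo $n$) be such that (a) $\mathbb{Z}_n=\langle u,v\rangle$; (b) $1<u<m$ and $u\mid m$; (c) every automorphism of the graph $H(\mathbb{Z}_n,S)$ that fixes the vertex $0^+$ leaves the set $\{0^-,u^-\}$ setwise fixed. Then, for every subset $T\subseteq\mathbb{Z}_n$, the graphs $H(\mathbb{Z}_n,S)$ and $H(\mathbb{Z}_n,T)$ are isomorphic if and only if there exist $a\in\mathbb{Z}_n^*$ (a unit of the ring $\mathbb{Z}/n\mathbb{Z}$) and $b\in\mathbb{Z}_n$ such that (1) $aT+b=S$;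 or (2) $aT+b=\{0,u+m,v,v+m\}$, and $2\mid u$, $2u\mid m$, and $u/2\not\equiv v+m/(2u)\pmod{m/u}$. Here $aT+b=\{at+b : t\in T\}$. -/

import Mathlib

/-- The Haar graph `H(G, S)` of an additive group `G`: `Sum.inl x` is the vertex `x⁺`,
`Sum.inr y` is the vertex `y⁻`, and the edges are the pairs `{x⁺, y⁻}` with `y - x ∈ S`. -/
def haarGraph {G : Type*} [AddGroup G] (S : Set G) : SimpleGraph (G ⊕ G) where
  Adj p q :=
    match p, q with
    | Sum.inl x, Sum.inr y => y - x ∈ S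
    | Sum.inr y, Sum.inl x => y - x ∈ S
    | Sum.inl _, Sum.inl _ => False
    | Sum.inr _, Sum.inr _ => False
  symm := ⟨by rintro (x | x) (y | y) h <;> exact h⟩
  loopless := ⟨by rintro (x | x) h <;> exact h⟩

/-! Both graphs may be compared by a colour-preserving isomorphism `(P, Q)` with `P 0 = Q 0 = 0`. By
(c), conjugated by translations, edges with differences in {0, u} stay distinguished from those with
differences in {v, v+m}. The latter form 4-cycles, which forces the images of v and v+m to differ by
m (`map_add_half`). The former form cycles of length 4k, where m = uk; walking along them gives
P(ju) = jW (`cycle_walk`), so W has the order of u and W = au for a unit a. Hence T is, up to affine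
maps, {0, u, z, z+m} with z prime to u. Since u·v is a multiple of u, P can be computed there along
v-edges and along the cycle through 0; this gives v ≡ z mod k, possibly after the reflection z ↦ u-z
(`HaarPair.exists_normal_form`).

What remains is arithmetic. A unit A = 1+kb with Az ≡ v mod m carries the normal form to {0, u+bm,
v, v+m}: even b gives (1), odd b gives (2). Odd b is forced only if u and k are even, and the
congruence excluded in (2) is what lets the reflection restore an even b.

Conversely, the sets in (2) are reached by a non-affine twist, adding m on alternate blocks of
length u (`exists_haarPair_twist`). -/

/-! ### Isomorphisms of Haar graphs as pairs of permutations -/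

/-- The pair `(P, Q)` of permutations of the two colour classes is an isomorphism
`H(G, S) ≅ H(G, T)`. -/
def HaarPair {G : Type*} [AddGroup G] (S T : Set G) (P Q : Equiv.Perm G) : Prop :=
  ∀ x y, y - x ∈ S ↔ Q y - P x ∈ T

/-- The colour-preserving graph isomorphism given by a pair of permutations. -/
def HaarPair.iso {G : Type*} [AddGroup G] {S T : Set G} {P Q : Equiv.Perm G}
    (h : HaarPair S T P Q) : haarGraph S ≃g haarGraph T where
  toEquiv := Equiv.sumCongr P Q
  map_rel_iff' := by
    rintro (x | x) (y | y)
    · exact Iff.rfl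
    · exact (h x y).symm
    · exact (h y x).symm
    · exact Iff.rfl

/-- The automorphism `x⁺ ↦ (-x)⁻`, `y⁻ ↦ (-y)⁺` of a Haar graph of an abelian group. -/
def haarSwap {G : Type*} [AddCommGroup G] (T : Set G) : haarGraph T ≃g haarGraph T where
  toEquiv := (Equiv.sumComm G G).trans (Equiv.sumCongr (Equiv.neg G) (Equiv.neg G))
  map_rel_iff' := by
    rintro (x | x) (y | y)
    · exact Iff.rfl
    · change -x - -y ∈ T ↔ y - x ∈ T
      rw [neg_sub_neg]
    · change -y - -x ∈ T ↔ x - y ∈ T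
      rw [neg_sub_neg]
    · exact Iff.rfl

theorem haarGraph_adj_isLeft {G : Type*} [AddGroup G] {T : Set G} {p q : G ⊕ G}
    (h : (haarGraph T).Adj p q) : p.isLeft = !q.isLeft := by
  rcases p with p | p <;> rcases q with q | q
  · exact h.elim
  · rfl
  · rfl
  · exact h.elim

/-- The vertices x⁺ and (x+s)⁺ share the neighbour (x+s)⁻ because 0 ∈ S, and S generates. So the
graph is connected, and the colour of the image of 0⁺ decides all the others. -/
theorem exists_haarPair_of_isLeft {G : Type*} [AddCommGroup G] {S T : Set G} (h0 : 0 ∈ S)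
    (hS : AddSubgroup.closure S = ⊤) (f : haarGraph S ≃g haarGraph T)
    (hf : (f (Sum.inl 0)).isLeft = true) : ∃ P Q, HaarPair S T P Q := by
  have hadj : ∀ x y, y - x ∈ S → (f (Sum.inl x)).isLeft = !(f (Sum.inr y)).isLeft :=
    fun x y hxy => haarGraph_adj_isLeft (f.map_adj_iff.2 hxy)
  have hstep : ∀ g : G, ∀ x, (f (Sum.inl (x + g))).isLeft = (f (Sum.inl x)).isLeft := by
    intro g
    have hg : g ∈ AddSubgroup.closure S := hS ▸ AddSubgroup.mem_top g
    induction hg using AddSubgroup.closure_induction with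
    | mem s hs =>
      intro x
      rw [hadj x (x + s) (by simpa using hs), hadj (x + s) (x + s) (by simpa using h0)]
    | zero => simp
    | add a b _ _ ha hb => intro x; rw [← add_assoc, hb, ha]
    | neg a _ ha => intro x; rw [← ha (x + -a), neg_add_cancel_right]
  have hl : ∀ x, (f (Sum.inl x)).isLeft = true := fun x => by
    rw [← hf, ← hstep x 0, zero_add]
  have hr : ∀ y, (f (Sum.inr y)).isLeft = false := fun y => by
    have := hadj y y (by simpa using h0)
    rw [hl] at this
    simpa using this.symm
  choose P hP using fun x => Sum.isLeft_iff.1 (hl x)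
  choose Q hQ using fun y => Sum.isRight_iff.1 (Sum.isLeft_eq_false.1 (hr y))
  have hPb : P.Bijective := by
    refine ⟨fun x y hxy => ?_, fun z => ?_⟩
    · exact Sum.inl_injective (f.injective (by rw [hP, hP, hxy]))
    · obtain ⟨x | y, hz⟩ := f.surjective (Sum.inl z)
      · exact ⟨x, Sum.inl_injective (by rw [← hP, hz])⟩
      · rw [hQ] at hz; cases hz
  have hQb : Q.Bijective := by
    refine ⟨fun x y hxy => ?_, fun z => ?_⟩
    · exact Sum.inr_injective (f.injective (by rw [hQ, hQ, hxy]))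
    · obtain ⟨x | y, hz⟩ := f.surjective (Sum.inr z)
      · rw [hP] at hz; cases hz
      · exact ⟨y, Sum.inr_injective (by rw [← hQ, hz])⟩
  refine ⟨Equiv.ofBijective P hPb, Equiv.ofBijective Q hQb, fun x y => ?_⟩
  have := f.map_adj_iff (v := Sum.inl x) (w := Sum.inr y)
  rw [hP, hQ] at this
  exact this.symm

theorem exists_haarPair {G : Type*} [AddCommGroup G] {S T : Set G} (h0 : 0 ∈ S)
    (hS : AddSubgroup.closure S = ⊤) (f : haarGraph S ≃g haarGraph T) :
    ∃ P Q, HaarPair S T P Q := by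
  cases hf : (f (Sum.inl 0)).isLeft with
  | true => exact exists_haarPair_of_isLeft h0 hS f hf
  | false =>
    refine exists_haarPair_of_isLeft h0 hS (f.trans (haarSwap T)) ?_
    obtain ⟨y, hy⟩ := Sum.isRight_iff.1 (Sum.isLeft_eq_false.1 hf)
    rw [RelIso.trans_apply, hy]
    rfl

/-- If the stabiliser of `0⁺` preserves a class `B` of neighbours, then every isomorphism maps
the edges of difference in `B` to edges whose differences lie in the image of `B`. -/
theorem HaarPair.sub_mem_image {G : Type*} [AddCommGroup G] {S T B : Set G}
    {P Q : Equiv.Perm G} (h : HaarPair S T P Q)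
    (hB : ∀ P Q, HaarPair S S P Q → P 0 = 0 → ∀ y ∈ B, Q y ∈ B) {x y : G} (hxy : y - x ∈ B) :
    ∃ b ∈ B, Q y - P x = Q b - P 0 := by
  -- Conjugating by the isomorphism, a translation of H(T) is combined with one of H(S) into an
  -- automorphism of H(S) that fixes 0⁺, so that `hB` applies.
  let P₁ : Equiv.Perm G := (Equiv.addRight x).trans (P.trans
    ((Equiv.addRight (P 0 - P x)).trans P.symm))
  let Q₁ : Equiv.Perm G := (Equiv.addRight x).trans (Q.trans
    ((Equiv.addRight (P 0 - P x)).trans Q.symm))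
  have hP : ∀ z, P (P₁ z) = P (z + x) + (P 0 - P x) := fun z => by simp [P₁]
  have hQ : ∀ z, Q (Q₁ z) = Q (z + x) + (P 0 - P x) := fun z => by simp [Q₁]
  have h1 : HaarPair S S P₁ Q₁ := fun a b => by
    rw [h (P₁ a) (Q₁ b), hP, hQ, add_sub_add_right_eq_sub, ← h, add_sub_add_right_eq_sub]
  have h0 : P₁ 0 = 0 := P.injective (by rw [hP, zero_add]; abel)
  refine ⟨_, hB P₁ Q₁ h1 h0 _ hxy, ?_⟩
  rw [hQ, sub_add_cancel]
  abel

/-! ### Affine equivalence and arithmetic modulo n -/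

theorem image_mul_add_eq_iff {R : Type*} [CommRing R] {S T : Set R} (a : Rˣ) (b : R) :
    (fun t : R => (a : R) * t + b) '' T = S ↔ ∀ t, t ∈ T ↔ (a : R) * t + b ∈ S := by
  have hinj : Function.Injective (fun t : R => (a : R) * t + b) := fun x y hxy =>
    a.isUnit.mul_right_injective (add_right_cancel hxy)
  constructor
  · rintro rfl t
    exact (hinj.mem_set_image).symm
  · intro h
    ext s
    constructor
    · rintro ⟨t, ht, rfl⟩
      exact (h t).1 ht
    · intro hs
      have hs' : (a : R) * ((↑a⁻¹ : R) * (s - b)) + b = s := by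
        rw [Units.mul_inv_cancel_left, sub_add_cancel]
      exact ⟨_, (h _).2 (by rwa [hs']), hs'⟩

theorem nonempty_haarGraph_iso_of_affine {R : Type*} [CommRing R] {S T : Set R} (a : Rˣ) (b : R)
    (h : (fun t : R => (a : R) * t + b) '' T = S) :
    Nonempty (haarGraph S ≃g haarGraph T) := by
  rw [image_mul_add_eq_iff] at h
  have : HaarPair T S a.mulLeft (a.mulLeft.trans (Equiv.addRight b)) := fun x y => by
    rw [h]
    change _ ↔ (a : R) * y + b - a * x ∈ S
    rw [show (a : R) * y + b - a * x = a * (y - x) + b by ring]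
  exact ⟨this.iso.symm⟩

theorem ZMod.eq_zero_or_eq_half_of_add_self {n m : ℕ} (hn : n = 2 * m) {x : ZMod n}
    (hx : x + x = 0) : x = 0 ∨ x = m := by
  obtain ⟨z, rfl⟩ := ZMod.intCast_surjective x
  have h2 : ((2 * z : ℤ) : ZMod n) = 0 := by push_cast; rw [two_mul]; exact hx
  rw [ZMod.intCast_zmod_eq_zero_iff_dvd] at h2
  obtain ⟨c, hc⟩ := h2
  have hz : z = m * c := by subst hn; push_cast at hc; linarith
  rcases Int.even_or_odd' c with ⟨d, rfl | rfl⟩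
  · left
    rw [ZMod.intCast_zmod_eq_zero_iff_dvd]
    exact ⟨d, by rw [hz, hn]; push_cast; ring⟩
  · right
    have : ((z - m : ℤ) : ZMod n) = 0 := by
      rw [ZMod.intCast_zmod_eq_zero_iff_dvd]
      exact ⟨d, by rw [hz, hn]; push_cast; ring⟩
    push_cast at this
    exact sub_eq_zero.1 this

theorem ZMod.half_add_half {n m : ℕ} (hn : n = 2 * m) : (m : ZMod n) + m = 0 := by
  rw [← Nat.cast_add, ← two_mul, ← hn, ZMod.natCast_self]

/-- Every residue is a unit times a divisor of n, and its order determines the divisor. -/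
theorem ZMod.exists_unit_mul_of_addOrderOf_eq {n u : ℕ} (hn : n ≠ 0) (hu : u ∣ n) {w : ZMod n}
    (hw : addOrderOf w = addOrderOf (u : ZMod n)) : ∃ a : (ZMod n)ˣ, w = a * u := by
  obtain ⟨d, hd, _, ⟨a, rfl⟩, rfl⟩ := ZMod.eq_unit_mul_divisor w
  have hda : addOrderOf ((a : ZMod n) * d) = addOrderOf (d : ZMod n) := by
    rw [addOrderOf_eq_addOrderOf_iff]
    intro j
    rw [← mul_smul_comm, Units.mul_right_eq_zero]
  rw [hda, ZMod.addOrderOf_coe _ hn, ZMod.addOrderOf_coe _ hn, Nat.gcd_eq_right hd,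
    Nat.gcd_eq_right hu] at hw
  have : d = u := by
    obtain ⟨e, rfl⟩ := hd
    have hd0 : 0 < d := Nat.pos_of_ne_zero (left_ne_zero_of_mul hn)
    have he0 : 0 < e := Nat.pos_of_ne_zero (right_ne_zero_of_mul hn)
    rw [Nat.mul_div_cancel_left _ hd0] at hw
    have h1 := Nat.div_mul_cancel hu
    rw [← hw, mul_comm d e] at h1
    exact (Nat.eq_of_mul_eq_mul_left he0 h1).symm
  exact ⟨a, by rw [this]⟩

theorem ZMod.isCoprime_of_closure_pair_eq_top {n u : ℕ} (hu : u ∣ n) {v : ℤ}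
    (h : AddSubgroup.closure {(u : ZMod n), (v : ZMod n)} = ⊤) : IsCoprime (u : ℤ) v := by
  obtain ⟨i, j, hij⟩ := AddSubgroup.mem_closure_pair.1 (h ▸ AddSubgroup.mem_top (1 : ZMod n))
  have h1 : ((1 - (i * u + j * v) : ℤ) : ZMod n) = 0 := by
    push_cast
    rw [← hij]
    simp
  obtain ⟨c, hc⟩ := (ZMod.intCast_zmod_eq_zero_iff_dvd _ _).1 h1
  obtain ⟨e, rfl⟩ := hu
  push_cast at hc
  exact ⟨i + e * c, j, by linear_combination -hc⟩

/-- If `v' ≡ v` modulo `k` and both are prime to `u`, then some `a ≡ 1` modulo `k` that is prime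
to `2uk` maps `v'` to `v` modulo `uk`; only for even `u` and `k` and `v' ≢ v` modulo `2k` can
`a ≡ 1` fail modulo `2k`. -/
theorem exists_isCoprime_mul_dvd_sub {u k v v' : ℤ} (hk0 : k ≠ 0) (hv : IsCoprime u v)
    (hv' : IsCoprime u v') (hk : k ∣ v - v') : ∃ b : ℤ, IsCoprime (1 + k * b) (2 * (u * k)) ∧
      u * k ∣ (1 + k * b) * v' - v ∧
      (2 ∣ b ∨ (2 ∣ u ∧ 2 ∣ k ∧ ¬ 2 ∣ b ∧ ¬ 2 * k ∣ v - v')) := by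
  obtain ⟨w, hw⟩ := hk
  have hcop : ∀ b, u ∣ b * v' - w → IsCoprime (1 + k * b) (u * k) ∧
      u * k ∣ (1 + k * b) * v' - v := by
    rintro b ⟨c, hc⟩
    have hav : (1 + k * b) * v' = v + u * (k * c) := by linear_combination k * hc - hw
    refine ⟨IsCoprime.mul_right ?_ ⟨1, -b, by ring⟩, c, by rw [hav]; ring⟩
    refine IsCoprime.of_mul_left_left (y := v') ?_
    rw [hav]
    exact IsCoprime.add_mul_left_left hv.symm _
  obtain ⟨b, hb⟩ : ∃ b, u ∣ b * v' - w := by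
    obtain ⟨s, t, hst⟩ := hv'
    exact ⟨w * t, -(w * s), by linear_combination w * hst⟩
  by_cases hu : 2 ∣ u
  · obtain ⟨h1, h2⟩ := hcop b hb
    have h3 : IsCoprime (1 + k * b) 2 :=
      (h1.of_mul_right_left).of_isCoprime_of_dvd_right hu
    refine ⟨b, h3.mul_right h1, h2, ?_⟩
    -- Here v' is odd, so b and w have the same parity; since 1 + kb is odd, an odd b needs k even.
    by_cases hb2 : 2 ∣ b
    · exact Or.inl hb2
    have hodd : ¬ 2 ∣ 1 + k * b := fun h =>
      absurd (h3.isUnit_of_dvd' h dvd_rfl) (by decide)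
    have hv2 : ¬ 2 ∣ v' := fun h => absurd (hv'.isUnit_of_dvd' hu h) (by decide)
    have hw2 : ¬ 2 ∣ w := fun h => by
      have h4 : 2 ∣ b * v' := by simpa using dvd_add (hu.trans hb) h
      exact (Int.prime_two.dvd_or_dvd h4).elim hb2 hv2
    refine Or.inr ⟨hu, ?_, hb2, ?_⟩
    · by_contra hk2
      apply hodd
      have := (Int.odd_mul.2 ⟨Int.not_even_iff_odd.1 (mt even_iff_two_dvd.1 hk2),
        Int.not_even_iff_odd.1 (mt even_iff_two_dvd.1 hb2)⟩)
      exact (odd_one.add_odd this).two_dvd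
    · rintro ⟨c, hc⟩
      exact hw2 ⟨c, mul_left_cancel₀ hk0 (by rw [← hw, hc]; ring)⟩
  -- For odd u, passing from b to b + u changes its parity.
  · obtain ⟨b', hb', hb2⟩ : ∃ b', u ∣ b' * v' - w ∧ 2 ∣ b' := by
      by_cases hb2 : 2 ∣ b
      · exact ⟨b, hb, hb2⟩
      · refine ⟨b + u, ?_, by omega⟩
        rw [show (b + u) * v' - w = (b * v' - w) + u * v' by ring]
        exact dvd_add hb (dvd_mul_right _ _)
    obtain ⟨h1, h2⟩ := hcop b' hb'
    refine ⟨b', IsCoprime.mul_right ?_ h1, h2, Or.inl hb2⟩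
    obtain ⟨c, rfl⟩ := hb2
    exact ⟨1, -(k * c), by ring⟩

/-! ### How an isomorphism acts on the two classes of edges -/

/-- The neighbours x⁻ and (x+U)⁻ of x⁺ have distinct images among Px and Px+W, so one determines the
other; likewise at the next vertex. The direction of travel therefore persists along a cycle. -/
theorem cycle_step_forward {R : Type*} [CommRing R] {P Q : Equiv.Perm R} {U W : R} (hU : U ≠ 0)
    (h1 : ∀ x, Q x = P x ∨ Q x = P x + W) (h2 : ∀ x, Q (x + U) = P x ∨ Q (x + U) = P x + W)
    {x : R} (hx : Q x = P x) : P (x + U) = P x + W ∧ Q (x + U) = P (x + U) := by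
  have hne : x + U ≠ x := by simpa using hU
  have hQ : Q (x + U) = P x + W := (h2 x).resolve_left fun h =>
    hne (Q.injective (h.trans hx.symm))
  have hP : Q (x + U) = P (x + U) := (h1 (x + U)).resolve_right fun h =>
    hne (P.injective (add_right_cancel (h.symm.trans hQ)))
  exact ⟨hP.symm.trans hQ, hP⟩

theorem cycle_step_backward {R : Type*} [CommRing R] {P Q : Equiv.Perm R} {U W : R} (hU : U ≠ 0)
    (h1 : ∀ x, Q x = P x ∨ Q x = P x + W) (h2 : ∀ x, Q (x + U) = P x ∨ Q (x + U) = P x + W)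
    {x : R} (hx : Q x = P x + W) : P (x + U) = P x - W ∧ Q (x + U) = P x := by
  have hne : x + U ≠ x := by simpa using hU
  have hQ : Q (x + U) = P x := (h2 x).resolve_right fun h =>
    hne (Q.injective (h.trans hx.symm))
  have hP : Q (x + U) = P (x + U) + W := (h1 (x + U)).resolve_left fun h =>
    hne (P.injective (h.symm.trans hQ))
  exact ⟨by rw [← hQ, hP, add_sub_cancel_right], hQ⟩

theorem cycle_walk {R : Type*} [CommRing R] {P Q : Equiv.Perm R} {U W : R} (hU : U ≠ 0)
    (h1 : ∀ x, Q x = P x ∨ Q x = P x + W) (h2 : ∀ x, Q (x + U) = P x ∨ Q (x + U) = P x + W)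
    (hP0 : P 0 = 0) (hQ0 : Q 0 = 0) (j : ℕ) :
    P (j * U) = j * W ∧ Q (j * U) = P (j * U) := by
  induction j with
  | zero => simp [hP0, hQ0]
  | succ j ih =>
    have h := cycle_step_forward hU h1 h2 ih.2
    have e : ((j + 1 : ℕ) : R) * U = j * U + U := by push_cast; ring
    rw [e]
    refine ⟨?_, h.2⟩
    rw [h.1, ih.1]
    push_cast
    ring

/-- Two vertices of the same colour with the same pair of neighbours along differences `V`,
`V + M` are mapped to vertices that differ by the unique involution `M`. -/
theorem map_add_half {R : Type*} [CommRing R] {P Q : Equiv.Perm R} {V M Z Z' : R} (hM : M ≠ 0)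
    (hMM : M + M = 0) (htor : ∀ d : R, d + d = 0 → d = 0 ∨ d = M)
    (h3 : ∀ x, Q (x + V) = P x + Z ∨ Q (x + V) = P x + Z')
    (h4 : ∀ x, Q (x + V + M) = P x + Z ∨ Q (x + V + M) = P x + Z') :
    Z' = Z + M ∧ ∀ x, P (x + M) = P x + M := by
  -- The images of x⁺ and (x+M)⁺ are distinct and have two common neighbours, along differences Z
  -- and Z'. These must be used crosswise, which gives the difference both as Z - Z' and as Z' - Z.
  have key : ∀ x, P (x + M) - P x = Z - Z' ∧ (Z - Z') + (Z - Z') = 0 := by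
    intro x
    have hP : P (x + M) ≠ P x := fun h => hM (by simpa using P.injective h)
    have hQ : Q (x + V + M) ≠ Q (x + V) := fun h => hM (by simpa using Q.injective h)
    have a1 := h3 x
    have a2 := h4 x
    have a3 := h3 (x + M)
    have a4 := h4 (x + M)
    rw [show x + M + V = x + V + M by ring] at a3
    rw [show x + M + V + M = x + V by linear_combination hMM] at a4
    rcases a1 with a1 | a1 <;> rcases a2 with a2 | a2
    · exact absurd (a2.trans a1.symm) hQ
    · rcases a4 with a4 | a4
      · exact absurd (add_right_cancel (a4.symm.trans a1)) hP
      rcases a3 with a3 | a3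
      · exact ⟨by linear_combination a1 - a4, by linear_combination a2 - a3 - a1 + a4⟩
      · exact absurd (add_right_cancel (a3.symm.trans a2)) hP
    · rcases a4 with a4 | a4
      · rcases a3 with a3 | a3
        · exact absurd (add_right_cancel (a3.symm.trans a2)) hP
        · exact ⟨by linear_combination a2 - a3, by linear_combination a1 - a4 - a2 + a3⟩
      · exact absurd (add_right_cancel (a4.symm.trans a1)) hP
    · exact absurd (a2.trans a1.symm) hQ
  have hd : Z - Z' = M := by
    refine (htor _ (key 0).2).resolve_left fun h => hM ?_
    have := (key 0).1
    rw [h, sub_eq_zero] at this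
    simpa using P.injective this
  refine ⟨by linear_combination -hMM - hd, fun x => ?_⟩
  linear_combination (key x).1 + hd

/-- Along the differences `V`, the map `P` is additive up to `M`, provided that `4W ≠ 0`. -/
theorem cross_walk {R : Type*} [CommRing R] {P Q : Equiv.Perm R} {U V W Z M : R} (hU : U ≠ 0)
    (hMM : M + M = 0) (hW : 4 * W ≠ 0)
    (h1 : ∀ x, Q x = P x ∨ Q x = P x + W) (h2 : ∀ x, Q (x + U) = P x ∨ Q (x + U) = P x + W)
    (h3 : ∀ x, Q (x + V) = P x + Z ∨ Q (x + V) = P x + (Z + M))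
    (hP0 : P 0 = 0) (hQ0 : Q 0 = 0) (i : ℕ) :
    (P (i * V) = i * Z ∨ P (i * V) = i * Z + M) ∧ Q (i * V) = P (i * V) := by
  induction i with
  | zero => simp [hP0, hQ0]
  | succ i ih =>
    obtain ⟨ih1, ih2⟩ := ih
    have e : ((i + 1 : ℕ) : R) * V = i * V + V := by push_cast; ring
    rw [e]
    set x := (i : R) * V
    -- If the cycle through x + V ran backward while that through x runs forward, Q(x+V+U) - Q(x+V)
    -- would be both -W and W up to M, so 4W = 0.
    have hQ : Q (x + V) = P (x + V) := by
      refine (h1 (x + V)).resolve_right fun h => hW ?_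
      have b1 := (cycle_step_backward hU h1 h2 h).2
      have b2 := (cycle_step_forward hU h1 h2 ih2).1
      have b3 := h3 x
      have b4 := h3 (x + U)
      rw [show x + U + V = x + V + U by ring] at b4
      rcases b3 with b3 | b3 <;> rcases b4 with b4 | b4
      · linear_combination -2 * (b4 - b3 - b1 + h + b2)
      · linear_combination -2 * (b4 - b3 - b1 + h + b2) - hMM
      · linear_combination -2 * (b4 - b3 - b1 + h + b2) + hMM
      · linear_combination -2 * (b4 - b3 - b1 + h + b2)
    refine ⟨?_, hQ⟩
    rw [← hQ]
    push_cast
    rcases h3 x with h | h <;> rcases ih1 with ih1 | ih1 <;> rw [h, ih1]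
    · left; ring
    · right; ring
    · right; ring
    · left; linear_combination hMM

/-! ### The normal form of T -/

theorem HaarPair.exists_normal_form {n m u k : ℕ} {v : ℤ} (hn : n = 2 * m) (hm : m = u * k)
    (hu : 1 < u) (hk : 2 ≤ k) {S T : Set (ZMod n)}
    (hS : S = {0, (u : ZMod n), (v : ZMod n), (v : ZMod n) + (m : ZMod n)})
    (ha : AddSubgroup.closure {(u : ZMod n), (v : ZMod n)} = ⊤)
    (hB : ∀ P Q, HaarPair S S P Q → P 0 = 0 →
      ∀ y, (Q y = 0 ∨ Q y = (u : ZMod n)) ↔ (y = 0 ∨ y = (u : ZMod n)))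
    {P Q : Equiv.Perm (ZMod n)} (h : HaarPair S T P Q) (hP0 : P 0 = 0) (hQ0 : Q 0 = 0) :
    ∃ (a : (ZMod n)ˣ) (z : ℤ),
      (∀ t, (a : ZMod n) * t ∈ T ↔
        t ∈ ({0, (u : ZMod n), (z : ZMod n), (z : ZMod n) + (m : ZMod n)} : Set (ZMod n))) ∧
      IsCoprime (u : ℤ) z ∧ ((k : ℤ) ∣ v - z ∨ (k : ℤ) ∣ v - (u - z)) := by
  have hun : u ∣ n := ⟨2 * k, by rw [hn, hm]; ring⟩
  have hn0 : n ≠ 0 := by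
    rw [hn, hm]; positivity
  have hcop := ZMod.isCoprime_of_closure_pair_eq_top hun ha
  have hMU : (m : ZMod n) = k * u := by rw [hm]; push_cast; ring
  have hMM := ZMod.half_add_half hn
  have htor : ∀ d : ZMod n, d + d = 0 → d = 0 ∨ d = m := fun d hd =>
    ZMod.eq_zero_or_eq_half_of_add_self hn hd
  have hmul : ∀ j : ℕ, (j : ZMod n) * u = 0 → 2 * k ∣ j := by
    intro j hj
    rw [← Nat.cast_mul, ZMod.natCast_eq_zero_iff, hn, hm] at hj
    obtain ⟨c, hc⟩ := hj
    exact ⟨c, Nat.eq_of_mul_eq_mul_right (by omega : 0 < u) (by rw [hc]; ring)⟩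
  have hM0 : (m : ZMod n) ≠ 0 := fun h0 => by
    have := Nat.le_of_dvd (by omega) (hmul k (by rw [← hMU, h0]))
    omega
  have hU0 : (u : ZMod n) ≠ 0 := fun h0 => by
    have := Nat.le_of_dvd (by omega) (hmul 1 (by rw [h0, mul_zero]))
    omega
  -- Since v is prime to u > 1, it is no multiple of u; as m is one, the classes {0, u} and {v, v+m}
  -- are disjoint.
  have hVne : ∀ c : ℤ, (v : ZMod n) ≠ c * u := fun c hc => by
    have h0 : ((v - c * u : ℤ) : ZMod n) = 0 := by push_cast; rw [hc, sub_self]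
    rw [ZMod.intCast_zmod_eq_zero_iff_dvd] at h0
    have h1 : (u : ℤ) ∣ v := by
      have := dvd_add ((Int.natCast_dvd_natCast.2 hun).trans h0) (dvd_mul_left (u : ℤ) c)
      simpa using this
    have := Int.isUnit_iff.1 (hcop.isUnit_of_dvd' dvd_rfl h1)
    omega
  set U : ZMod n := (u : ZMod n)
  set V : ZMod n := (v : ZMod n)
  set M : ZMod n := (m : ZMod n)
  have hB1 : ∀ P Q, HaarPair S S P Q → P 0 = 0 → ∀ y ∈ ({0, U} : Set (ZMod n)),
      Q y ∈ ({0, U} : Set (ZMod n)) := fun P Q h hP y hy => (hB P Q h hP y).2 hy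
  have hB2 : ∀ P Q, HaarPair S S P Q → P 0 = 0 → ∀ y ∈ ({V, V + M} : Set (ZMod n)),
      Q y ∈ ({V, V + M} : Set (ZMod n)) := by
    intro P Q h hP y hy
    have hyS : y - 0 ∈ S := by
      rw [hS, sub_zero]; exact Or.inr (Or.inr hy)
    have hQS := (h 0 y).1 hyS
    rw [hP, sub_zero, hS] at hQS
    have hny : ¬ (y = 0 ∨ y = U) := by
      rcases hy with rfl | rfl
      · rintro (h0 | h0)
        · exact hVne 0 (by rw [h0]; simp)
        · exact hVne 1 (by rw [h0]; simp)
      · rintro (h0 | h0)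
        · exact hVne (-k) (by push_cast; linear_combination h0 - hMU)
        · exact hVne (1 - k) (by push_cast; linear_combination h0 - hMU)
    rcases hQS with h0 | h0 | h0
    · exact absurd ((hB P Q h hP y).1 (Or.inl h0)) hny
    · exact absurd ((hB P Q h hP y).1 (Or.inr h0)) hny
    · exact h0
  set W := Q U with hW
  set Z := Q V with hZ
  set Z' := Q (V + M) with hZ'
  have e1 : ∀ x y, y - x = 0 ∨ y - x = U → Q y = P x ∨ Q y = P x + W := by
    intro x y hxy
    obtain ⟨b, rfl | rfl, hb⟩ := h.sub_mem_image hB1 (x := x) (y := y) hxy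
    · left; rw [hQ0, hP0, sub_self, sub_eq_zero] at hb; exact hb
    · right; rw [hP0, sub_zero, sub_eq_iff_eq_add] at hb; rw [hb, add_comm]
  have e2 : ∀ x y, y - x = V ∨ y - x = V + M → Q y = P x + Z ∨ Q y = P x + Z' := by
    intro x y hxy
    obtain ⟨b, rfl | rfl, hb⟩ := h.sub_mem_image hB2 (x := x) (y := y) hxy
    · left; rw [hP0, sub_zero, sub_eq_iff_eq_add] at hb; rw [hb, add_comm]
    · right; rw [hP0, sub_zero, sub_eq_iff_eq_add] at hb; rw [hb, add_comm]
  have h1 : ∀ x, Q x = P x ∨ Q x = P x + W := fun x => e1 x x (by simp)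
  have h2 : ∀ x, Q (x + U) = P x ∨ Q (x + U) = P x + W := fun x => e1 x (x + U) (by simp)
  have h3 := fun x => e2 x (x + V) (by simp)
  have h4 := fun x => e2 x (x + V + M) (by right; ring)
  obtain ⟨hZM, hPM⟩ := map_add_half hM0 hMM htor h3 h4
  rw [hZM] at h3
  have hwalk := cycle_walk hU0 h1 h2 hP0 hQ0
  obtain ⟨a, haW⟩ : ∃ a : (ZMod n)ˣ, W = a * U := by
    refine ZMod.exists_unit_mul_of_addOrderOf_eq hn0 hun ?_
    rw [addOrderOf_eq_addOrderOf_iff]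
    intro j
    rw [nsmul_eq_mul, nsmul_eq_mul, ← (hwalk j).1]
    constructor
    · intro hj; exact P.injective (hj.trans hP0.symm)
    · intro hj; rw [hj, hP0]
  obtain ⟨z, hz⟩ := ZMod.intCast_surjective ((↑a⁻¹ : ZMod n) * Z)
  have hZa : Z = a * z := by rw [hz, Units.mul_inv_cancel_left]
  have hMW : M = k * W := by
    rw [← (hwalk k).1, ← hMU, ← zero_add M, hPM, hP0]
  have haM : a * M = M := by
    rw [hMU, mul_left_comm, ← haW, ← hMW, hMU]
  -- Connectedness carries over: every value of P lies in ⟨W, Z⟩ = a⟨u, z⟩, and P is surjective.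
  have hcz : IsCoprime (u : ℤ) z := by
    let K := AddSubgroup.closure {W, Z}
    have hWK : W ∈ K := AddSubgroup.subset_closure (by simp)
    have hZK : Z ∈ K := AddSubgroup.subset_closure (by simp)
    have hMK : M ∈ K := by rw [hMW, ← nsmul_eq_mul]; exact K.nsmul_mem hWK k
    have hQP : ∀ x, Q x - P x ∈ K := fun x => by
      rcases h1 x with h | h <;> rw [h]
      · simp [K.zero_mem]
      · simpa using hWK
    have hstep : ∀ g, ∀ x, P (x + g) - P x ∈ K := by
      intro g
      have hg : g ∈ AddSubgroup.closure {U, V} := ha ▸ AddSubgroup.mem_top g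
      induction hg using AddSubgroup.closure_induction with
      | mem g hg =>
        intro x
        rw [← sub_sub_sub_cancel_left (c := Q (x + g)), ← neg_sub]
        refine K.neg_mem (K.sub_mem (hQP _) ?_)
        rcases hg with rfl | rfl
        · rcases h2 x with h | h <;> rw [h]
          · simp [K.zero_mem]
          · simpa using hWK
        · rcases h3 x with h | h <;> rw [h]
          · simpa using hZK
          · simpa using K.add_mem hZK hMK
      | zero => simp [K.zero_mem]
      | add b c _ _ hb hc =>
        intro x
        have := K.add_mem (hc (x + b)) (hb x)
        rwa [sub_add_sub_cancel, add_assoc] at this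
      | neg b _ hb =>
        intro x
        have := K.neg_mem (hb (x + -b))
        rwa [neg_sub, neg_add_cancel_right] at this
    refine ZMod.isCoprime_of_closure_pair_eq_top hun ((AddSubgroup.eq_top_iff' _).2 fun y => ?_)
    obtain ⟨x, hx⟩ := P.surjective (a * y)
    have hy := hstep x 0
    rw [zero_add, hP0, sub_zero, hx] at hy
    obtain ⟨i, j, hij⟩ := AddSubgroup.mem_closure_pair.1 hy
    refine AddSubgroup.mem_closure_pair.2 ⟨i, j, a.isUnit.mul_right_injective ?_⟩
    change (a : ZMod n) * _ = a * y
    rw [← hij, haW, hZa, mul_add, mul_smul_comm, mul_smul_comm]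
  refine ⟨a, z, fun t => ?_, hcz, ?_⟩
  · have hT : ∀ s, s ∈ T ↔ s = 0 ∨ s = W ∨ s = Z ∨ s = Z' := by
      intro s
      obtain ⟨y, rfl⟩ := Q.surjective s
      have := h 0 y
      rw [hP0, sub_zero, sub_zero, hS] at this
      have h0 : Q y = 0 ↔ y = 0 := by rw [← Q.injective.eq_iff (a := y), hQ0]
      rw [← this, h0, hW, hZ, hZ', Q.injective.eq_iff, Q.injective.eq_iff, Q.injective.eq_iff]
      rfl
    have hinj : ∀ s, (a : ZMod n) * t = a * s ↔ t = s := fun s =>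
      a.isUnit.mul_right_injective.eq_iff
    have hzM : (a : ZMod n) * z + M = a * (z + M) := by rw [mul_add, haM]
    rw [hT, hZM, haW, hZa, hzM, hinj, hinj, hinj, Units.mul_right_eq_zero]
    rfl
  -- For k = 2 one has 4W = 0 and `cross_walk` fails, but parity suffices: even u makes v and z odd,
  -- while for odd u one of v - z and v - (u - z) is even.
  · rcases hk.eq_or_lt with rfl | hk
    · have hne : ∀ {p q : ℤ}, IsCoprime p q → ¬ (2 ∣ p ∧ 2 ∣ q) := fun hpq h2 =>
        absurd (hpq.isUnit_of_dvd' h2.1 h2.2) (by decide)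
      have := hne hcop
      have := hne hcz
      push_cast
      omega
    · left
      have h4W : 4 * W ≠ 0 := fun h0 => by
        have h4 := (hwalk 4).1
        push_cast at h4
        rw [h0, ← hP0] at h4
        have := Nat.le_of_dvd (by omega) (hmul 4 (by push_cast; exact P.injective h4))
        omega
      have hx := (cross_walk hU0 hMM h4W h1 h2 h3 hP0 hQ0 u).1
      have : NeZero n := ⟨hn0⟩
      have hVU : U * V = (V.val : ZMod n) * U := by rw [ZMod.natCast_zmod_val, mul_comm]
      change P (U * V) = U * Z ∨ P (U * V) = U * Z + M at hx
      rw [hVU, (hwalk V.val).1, ZMod.natCast_zmod_val, haW, hZa] at hx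
      -- Doubling removes the ambiguity M left by the walk along V.
      have h5 : (a : ZMod n) * (2 * (U * (V - z))) = 0 := by
        rcases hx with hx | hx
        · linear_combination 2 * hx
        · linear_combination 2 * hx + hMM
      rw [Units.mul_right_eq_zero] at h5
      have h6 : ((2 * (u * (v - z)) : ℤ) : ZMod n) = 0 := by push_cast; exact h5
      rw [ZMod.intCast_zmod_eq_zero_iff_dvd, hn, hm] at h6
      obtain ⟨c, hc⟩ := h6
      have hu0 : (2 * u : ℤ) ≠ 0 := by omega
      exact ⟨c, mul_left_cancel₀ hu0 (by rw [mul_assoc, hc]; push_cast; ring)⟩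

/-! ### The non-affine isomorphism -/

/-- Adding `m` to every other vertex of each `u`-cycle gives an isomorphism between the Haar graphs
of `{0, u, v, v + m}` and `{0, u + m, v, v + m}`. -/
theorem exists_haarPair_twist {n m u : ℕ} (hn : n = 2 * m) (hu : 0 < u) (hm0 : 0 < m)
    (hm : 2 * u ∣ m) (V : ZMod n) :
    ∃ P, HaarPair {0, (u : ZMod n), V, V + (m : ZMod n)}
      {0, (u : ZMod n) + (m : ZMod n), V, V + (m : ZMod n)} P P := by
  have : NeZero n := ⟨by omega⟩
  obtain ⟨e, he⟩ := hm
  have hMM := ZMod.half_add_half hn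
  have hpar : ∀ i : ℕ, (i : ZMod n) * m = 0 ∨ (i : ZMod n) * m = m := by
    intro i
    refine ZMod.eq_zero_or_eq_half_of_add_self hn ?_
    rw [← mul_add, hMM, mul_zero]
  -- Only the parity of the block number matters. It is consistent across the wrap from n to 0, as
  -- n/u = 4e is even; m/u = 2e being even makes c invariant under adding m, whence x ↦ x + c x is
  -- an involution.
  let c : ZMod n → ZMod n := fun x => ((x.val / u : ℕ) : ZMod n) * m
  have hc : ∀ x, c x = 0 ∨ c x = m := fun x => hpar _
  have hcc : ∀ x, c x + c x = 0 := fun x => by rcases hc x with h | h <;> simp [h, hMM]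
  have hcu : ∀ x, c (x + u) = c x + m := by
    intro x
    have hlt := x.val_lt
    have hun : u < n := by
      have : u ≤ m := Nat.le_of_dvd hm0 ⟨2 * e, by rw [he]; ring⟩
      omega
    have hval : (x + u).val = (x.val + u) % n := by
      rw [ZMod.val_add, ZMod.val_natCast, Nat.mod_eq_of_lt hun]
    have hmul : n = (4 * e) * u := by rw [hn, he]; ring
    have hdiv : (x.val + u) / u = x.val / u + 1 := Nat.add_div_right _ hu
    simp only [c, hval]
    rcases lt_or_ge (x.val + u) n with h | h
    · rw [Nat.mod_eq_of_lt h, hdiv]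
      push_cast
      ring
    · have h3 : (x.val + u) % n = x.val + u - n := by
        rw [Nat.mod_eq_sub_mod h, Nat.mod_eq_of_lt (by omega)]
      have h4 : (x.val + u) / u = (x.val + u - n) / u + 4 * e := by
        rw [← Nat.add_mul_div_right _ _ hu, ← hmul, Nat.sub_add_cancel h]
      have h5 : (((x.val + u - n) / u + 4 * e : ℕ) : ZMod n) = ((x.val / u + 1 : ℕ) : ZMod n) := by
        rw [← h4, hdiv]
      rw [h3]
      push_cast at h5 ⊢
      linear_combination (m : ZMod n) * h5 - 2 * (e : ZMod n) * hMM
  have hcm : ∀ x, c (x + m) = c x := by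
    have hj : ∀ (j : ℕ) x, c (x + j * u) = c x + j * m := by
      intro j
      induction j with
      | zero => simp
      | succ j ih =>
        intro x
        rw [show x + ((j + 1 : ℕ) : ZMod n) * u = (x + j * u) + u by push_cast; ring, hcu, ih]
        push_cast
        ring
    intro x
    have hme : (m : ZMod n) = ((2 * e : ℕ) : ZMod n) * u := by
      rw [← Nat.cast_mul]; congr 1; rw [he]; ring
    conv_lhs => rw [hme]
    rw [hj]
    push_cast
    linear_combination (e : ZMod n) * hMM
  have hinv : Function.Involutive fun x => x + c x := by
    intro x
    change x + c x + c (x + c x) = x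
    have : c (x + c x) = c x := by
      rcases hc x with h | h <;> rw [h]
      · rw [add_zero, h]
      · rw [hcm, h]
    rw [this, add_assoc, hcc, add_zero]
  have hVM : ∀ {d e : ZMod n}, e = 0 ∨ e = m → d = V ∨ d = V + m → d + e = V ∨ d + e = V + m := by
    rintro d e (rfl | rfl) (rfl | rfl)
    · simp
    · simp
    · simp
    · left; linear_combination hMM
  have hdiff : ∀ x y, c y - c x = 0 ∨ c y - c x = m := by
    intro x y
    exact ZMod.eq_zero_or_eq_half_of_add_self hn (by linear_combination hcc y - hcc x)
  refine ⟨hinv.toPerm _, fun x y => ?_⟩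
  change _ ↔ y + c y - (x + c x) ∈ _
  have hd : y + c y - (x + c x) = (y - x) + (c y - c x) := by ring
  constructor
  · rintro (h | h | h)
    · left
      rw [sub_eq_zero.1 h, sub_self]
    · right; left
      have : y = x + u := by linear_combination h
      rw [this, hcu]; ring
    · right; right
      rw [hd]
      exact hVM (hdiff x y) h
  · rintro (h | h | h)
    · left
      have : y + c y = x + c x := sub_eq_zero.1 h
      exact sub_eq_zero.2 (hinv.injective this)
    · right; left
      have : y = x + u := by
        apply hinv.injective
        change y + c y = x + u + c (x + u)
        rw [hcu]
        linear_combination h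
      rw [this]; ring
    · right; right
      have := hVM (hdiff x y) h
      rwa [hd, add_assoc, show c y - c x + (c y - c x) = 0 by linear_combination hcc y - hcc x,
        add_zero] at this

/-! ### From the normal form to the two cases -/

/-- The condition that `a T + c = {0, u, z, z + m}`, with `z` prime to `u`. -/
def IsAffineNormal {n : ℕ} (m u : ℕ) (T : Set (ZMod n)) (z : ℤ) : Prop :=
  IsCoprime (u : ℤ) z ∧ ∃ (a : (ZMod n)ˣ) (c : ZMod n), ∀ t, t ∈ T ↔ (a : ZMod n) * t + c ∈
    ({0, (u : ZMod n), (z : ZMod n), (z : ZMod n) + (m : ZMod n)} : Set (ZMod n))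

/-- The map t ↦ u - t exchanges 0 and u, and sends z + m to u - z + m because 2m = 0. -/
theorem IsAffineNormal.reflect {n m u : ℕ} (hn : n = 2 * m) {T : Set (ZMod n)} {z : ℤ}
    (h : IsAffineNormal m u T z) : IsAffineNormal m u T (u - z) := by
  obtain ⟨hz, a, c, hT⟩ := h
  have hMM := ZMod.half_add_half hn
  refine ⟨?_, -a, u - c, fun t => ?_⟩
  · have := hz.neg_right.add_mul_left_right 1
    rwa [mul_one, neg_add_eq_sub] at this
  · rw [hT, Units.val_neg, neg_mul]
    generalize (a : ZMod n) * t = s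
    simp only [Set.mem_insert_iff, Set.mem_singleton_iff]
    push_cast
    constructor
    · rintro (h | h | h | h)
      · right; left; linear_combination -h
      · left; linear_combination -h
      · right; right; left; linear_combination -h
      · right; right; right; linear_combination -h - hMM
    · rintro (h | h | h | h)
      · right; left; linear_combination -h
      · left; linear_combination -h
      · right; right; left; linear_combination -h
      · right; right; right; linear_combination -h - hMM

/-- Multiplying by A = 1 + kb sends u to u + bm since ku = m, and fixes m since A is odd. As Az is v
modulo m, it is v or v + m, and either way the pair {z, z+m} goes to {v, v+m}. -/
theorem exists_unit_normal_iff {n m u k : ℕ} (hn : n = 2 * m) (hm : m = u * k) {v z b : ℤ}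
    (h1 : IsCoprime (1 + k * b) (2 * (u * k) : ℤ)) (h2 : (u * k : ℤ) ∣ (1 + k * b) * z - v) :
    ∃ A : (ZMod n)ˣ, ∀ t, t ∈ ({0, (u : ZMod n), (z : ZMod n), (z : ZMod n) + (m : ZMod n)} :
        Set (ZMod n)) ↔ (A : ZMod n) * t ∈
      ({0, (u : ZMod n) + b * (m : ZMod n), (v : ZMod n), (v : ZMod n) + (m : ZMod n)} :
        Set (ZMod n)) := by
  have hMM := ZMod.half_add_half hn
  have hMU : (m : ZMod n) = k * u := by rw [hm]; push_cast; ring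
  have hnZ : (n : ℤ) = 2 * (u * k) := by rw [hn, hm]; push_cast; ring
  have hco : IsCoprime (1 + k * b : ℤ) n := by rwa [hnZ]
  set A := ZMod.unitOfIsCoprime _ hco
  have hA : (A : ZMod n) = 1 + k * b := by
    rw [ZMod.coe_unitOfIsCoprime]; push_cast; rfl
  have hAu : (u : ZMod n) + b * (m : ZMod n) = A * u := by
    rw [hA, hMU]; ring
  have hAM : (A : ZMod n) * m = m := by
    have hodd : ¬ 2 ∣ 1 + k * b := fun h =>
      absurd ((IsCoprime.of_mul_right_left h1).isUnit_of_dvd' h dvd_rfl) (by decide)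
    have h3 : ¬ Even (1 + k * b : ℤ) := mt even_iff_two_dvd.1 hodd
    obtain ⟨r, hr⟩ := Int.not_even_iff_odd.1 h3
    have : (A : ZMod n) = 2 * r + 1 := by
      rw [ZMod.coe_unitOfIsCoprime, hr]; push_cast; rfl
    rw [this]
    linear_combination (r : ZMod n) * hMM
  have hAz : (A : ZMod n) * z = v ∨ (A : ZMod n) * z = v + m := by
    have h4 : ((2 * ((1 + k * b) * z - v) : ℤ) : ZMod n) = 0 := by
      rw [ZMod.intCast_zmod_eq_zero_iff_dvd, hnZ]
      exact mul_dvd_mul_left 2 h2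
    have h5 : ((A : ZMod n) * z - v) + (A * z - v) = 0 := by
      push_cast at h4
      rw [hA]
      linear_combination h4
    rcases ZMod.eq_zero_or_eq_half_of_add_self hn h5 with h | h
    · left; exact sub_eq_zero.1 h
    · right; linear_combination h
  refine ⟨A, fun t => ?_⟩
  have hinj : ∀ s, (A : ZMod n) * t = A * s ↔ t = s := fun s =>
    A.isUnit.mul_right_injective.eq_iff
  have hlast : (A : ZMod n) * t = v ∨ (A : ZMod n) * t = v + m ↔ t = z ∨ t = z + m := by
    rw [← hinj z, ← hinj (z + m), mul_add, hAM]
    rcases hAz with h | h <;> rw [h]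
    rw [add_assoc, hMM, add_zero, or_comm]
  simp only [Set.mem_insert_iff, Set.mem_singleton_iff]
  rw [hlast, hAu, hinj, Units.mul_right_eq_zero]

theorem IsAffineNormal.exists_affine {n m u k : ℕ} (hn : n = 2 * m) (hm : m = u * k)
    {T : Set (ZMod n)} {v z b : ℤ} (hT : IsAffineNormal m u T z)
    (h1 : IsCoprime (1 + k * b) (2 * (u * k) : ℤ)) (h2 : (u * k : ℤ) ∣ (1 + k * b) * z - v) :
    ∃ (a : (ZMod n)ˣ) (c : ZMod n), (fun t : ZMod n => (a : ZMod n) * t + c) '' T =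
      {0, (u : ZMod n) + b * (m : ZMod n), (v : ZMod n), (v : ZMod n) + (m : ZMod n)} := by
  obtain ⟨-, a, c, hT⟩ := hT
  obtain ⟨A, hA⟩ := exists_unit_normal_iff hn hm h1 h2
  refine ⟨A * a, A * c, (image_mul_add_eq_iff _ _).2 fun t => ?_⟩
  rw [hT, hA, Units.val_mul, mul_add, mul_assoc]

/-! ### Proof of the theorem -/

theorem theorem3p1 (n m u : ℕ) (v : ℤ) (hn : n = 2 * m)
    (S : Set (ZMod n))
    (hS : S = {0, (u : ZMod n), (v : ZMod n), (v : ZMod n) + (m : ZMod n)})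
    (ha : AddSubgroup.closure {(u : ZMod n), (v : ZMod n)} = ⊤)
    (hb : 1 < u ∧ u < m ∧ u ∣ m)
    (hc : ∀ g : haarGraph S ≃g haarGraph S, g (Sum.inl 0) = Sum.inl 0 →
      g '' {Sum.inr 0, Sum.inr (u : ZMod n)} = {Sum.inr 0, Sum.inr (u : ZMod n)})
    (T : Set (ZMod n)) :
    Nonempty (haarGraph S ≃g haarGraph T) ↔
      ∃ (a : (ZMod n)ˣ) (b : ZMod n),
        (fun t : ZMod n => (a : ZMod n) * t + b) '' T = S ∨
        ((fun t : ZMod n => (a : ZMod n) * t + b) '' T =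
            {0, (u : ZMod n) + (m : ZMod n), (v : ZMod n), (v : ZMod n) + (m : ZMod n)} ∧
          2 ∣ u ∧ 2 * u ∣ m ∧
          ¬ ((u / 2 : ℕ) : ℤ) ≡ v + ((m / (2 * u) : ℕ) : ℤ) [ZMOD ((m / u : ℕ) : ℤ)]) := by
  obtain ⟨hu1, hum, k, hm⟩ := hb
  have hk : 2 ≤ k := by
    by_contra hk
    have : u * k ≤ u * 1 := Nat.mul_le_mul_left u (by omega)
    omega
  have hMM := ZMod.half_add_half hn
  constructor
  · rintro ⟨f⟩
    have hcl : AddSubgroup.closure S = ⊤ := by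
      refine top_unique (ha ▸ AddSubgroup.closure_mono ?_)
      rw [hS]
      rintro x (rfl | rfl)
      · simp
      · simp
    obtain ⟨P, Q, h⟩ := exists_haarPair (by simp [hS]) hcl f
    have hB : ∀ P Q, HaarPair S S P Q → P 0 = 0 →
        ∀ y, (Q y = 0 ∨ Q y = (u : ZMod n)) ↔ (y = 0 ∨ y = (u : ZMod n)) := by
      intro P Q h hP y
      have h1 := hc h.iso (congrArg Sum.inl hP)
      have h2 : (Sum.inr (Q y) : ZMod n ⊕ ZMod n) ∈ h.iso '' {Sum.inr 0, Sum.inr (u : ZMod n)} ↔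
          (Sum.inr y : ZMod n ⊕ ZMod n) ∈ ({Sum.inr 0, Sum.inr (u : ZMod n)} : Set _) :=
        h.iso.injective.mem_set_image (a := Sum.inr y)
      rw [h1] at h2
      simpa using h2
    obtain ⟨a, z, hT, hcz, hkz⟩ := HaarPair.exists_normal_form (P := P.trans (Equiv.subRight (P 0)))
      (Q := Q.trans (Equiv.subRight (Q 0))) (T := {t | t + (Q 0 - P 0) ∈ T}) hn hm hu1 hk hS ha hB
      (fun x y => by
        rw [h]
        change _ ↔ Q y - Q 0 - (P x - P 0) + (Q 0 - P 0) ∈ T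
        rw [show Q y - Q 0 - (P x - P 0) + (Q 0 - P 0) = Q y - P x by ring])
      (by simp) (by simp)
    have hN : IsAffineNormal m u T z := by
      refine ⟨hcz, a⁻¹, -(↑a⁻¹ * (Q 0 - P 0)), fun t => ?_⟩
      rw [← hT, ← sub_eq_add_neg, ← mul_sub, Units.mul_inv_cancel_left]
      change _ ↔ t - (Q 0 - P 0) + (Q 0 - P 0) ∈ T
      rw [sub_add_cancel]
    have hcop := ZMod.isCoprime_of_closure_pair_eq_top ⟨2 * k, by rw [hn, hm]; ring⟩ ha
    obtain ⟨z, hN, hkz⟩ : ∃ z, IsAffineNormal m u T z ∧ (k : ℤ) ∣ v - z :=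
      hkz.elim (fun h => ⟨z, hN, h⟩) fun h => ⟨u - z, hN.reflect hn, h⟩
    have hk0 : (k : ℤ) ≠ 0 := by omega
    have heven : ∀ b : ℤ, 2 ∣ b → (b : ZMod n) * m = 0 := by
      rintro _ ⟨c, rfl⟩
      push_cast
      linear_combination (c : ZMod n) * hMM
    obtain ⟨b, h1, h2, hb2 | ⟨hu2, hk2, hb2, hnd⟩⟩ :=
      exists_isCoprime_mul_dvd_sub hk0 hcop hN.1 hkz
    · obtain ⟨a, c, hac⟩ := hN.exists_affine hn hm h1 h2
      rw [heven b hb2, add_zero, ← hS] at hac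
      exact ⟨a, c, Or.inl hac⟩
    have hmu : m / u = k := by rw [hm, Nat.mul_div_cancel_left _ (by omega)]
    obtain ⟨u', hu'⟩ : 2 ∣ u := by exact_mod_cast hu2
    obtain ⟨k', hk'⟩ : 2 ∣ k := by exact_mod_cast hk2
    have hm2 : m / (2 * u) = k' := by
      rw [hm, hk', mul_left_comm, ← mul_assoc, Nat.mul_div_cancel_left _ (by omega)]
    by_cases hcond : ((u / 2 : ℕ) : ℤ) ≡ v + ((m / (2 * u) : ℕ) : ℤ) [ZMOD ((m / u : ℕ) : ℤ)]
    · rw [hmu, hm2, hu', Nat.mul_div_cancel_left _ two_pos, Int.modEq_iff_dvd] at hcond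
      obtain ⟨r, hr⟩ := hcond
      obtain ⟨w, hw⟩ := hkz
      have hw2 : ¬ 2 ∣ w := by
        rintro ⟨s, rfl⟩
        exact hnd ⟨s, by rw [hw]; ring⟩
      -- The congruence doubles to 2v - u = k(2r - 1). As w is odd, v - (u - z) is a multiple of 2k,
      -- so the reflected form admits an even b.
      have hrz : v - (u - z) = k * (2 * r - 1 - w) := by
        rw [hu', hk'] at *
        push_cast at *
        linear_combination 2 * hr - hw
      obtain ⟨b, h1, h2, hb2 | ⟨-, -, -, hnd'⟩⟩ :=
        exists_isCoprime_mul_dvd_sub hk0 hcop (hN.reflect hn).1 ⟨_, hrz⟩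
      · obtain ⟨a, c, hac⟩ := (hN.reflect hn).exists_affine hn hm h1 h2
        rw [heven b hb2, add_zero, ← hS] at hac
        exact ⟨a, c, Or.inl hac⟩
      · refine absurd ?_ hnd'
        obtain ⟨s, hs⟩ : 2 ∣ 2 * r - 1 - w := by omega
        exact ⟨s, by rw [hrz, hs]; ring⟩
    · obtain ⟨a, c, hac⟩ := hN.exists_affine hn hm h1 h2
      have hbm : (b : ZMod n) * m = m := by
        have := heven (b - 1) (by omega)
        push_cast at this
        linear_combination this
      rw [hbm] at hac
      exact ⟨a, c, Or.inr ⟨hac, ⟨u', hu'⟩, ⟨k', by rw [hm, hk']; ring⟩, hcond⟩⟩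
  · rintro ⟨a, b, h | ⟨h, -, h2, -⟩⟩
    · exact nonempty_haarGraph_iso_of_affine a b h
    · obtain ⟨P, hP⟩ := exists_haarPair_twist hn (by omega) (by omega) h2 (v : ZMod n)
      obtain ⟨f⟩ := nonempty_haarGraph_iso_of_affine a b h
      rw [hS]
      exact ⟨hP.iso.trans f⟩
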